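/- A \emph{permutation} is a finite sequence $\pi=\pi_1\pi_2\cdots\pi_m$ of distinct positive integers ($m=|\pi|\ge 0$). If $\pi$ and $\sigma$ are permutations with no common entries, a \emph{shuffle} of $\pi$ and $\sigma$ is a permutation $\tau$ whose set of entries is the union of the sets of entries of $\pi$ and $\sigma$ and which contains both $\pi$ and $\sigma$ as (not necessarily contiguous) subsequences; $S(\pi,\sigma)$ denotes the set of all shuffles. A \emph{permutation statistic} is a function $\mathrm{St}$ on the set of all permutations such that $\mathrm{St}(\pi)$ depends only on the relative order of the entries of $\pi$. It is \emph{shuffle compatible} if, for all permutations $\pi,\pi',\sigma,\sigma'$ such that $|\pi|=|\pi'|$, $|\sigma|=|\sigma'|$, $\pi$ and $\sigma$ have no common entries, $\pi'$ and $\sigma'$ have no common entries, $\mathrm{St}(\pi)=\mathrm{St}(\pi')$ and $\mathrm{St}(\sigma)=\mathrm{St}(\sigma')$, there is an equality of multisets $$\{\{\mathrm{St}(\tau) : \tau\in S(\pi,\sigma)\}\}=\{\{\mathrm{St}(\tau) : \tau\in S(\pi',\sigma')\}\}.$$ A \emph{peak} of a sequence $w_1\cdots w_m$ is a position $i$ with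 $2\le i\le m-1$ and $w_{i-1}<w_i>w_{i+1}$. For a permutation $\pi$ let $\mathrm{pk}(\pi)$, $\mathrm{lpk}(\pi)$, $\mathrm{rpk}(\pi)$, $\mathrm{epk}(\pi)$ be the numbers of peaks of the sequences $\pi$, $0\pi$, $\pi0$, $0\pi0$ respectively (where $0$ is added as an extra first and/or last entry). Let $\mathrm{udr}(\pi)$ be the number of maximal monotone factors of $0\pi$, that is, of nonempty contiguous subsequences of $0\pi$ that are strictly increasing or strictly decreasing and are not properly contained in another such contiguous subsequence. \textbf{Theorem.} The statistics $\mathrm{lpk}$, $\mathrm{rpk}$, $\mathrm{epk}$, $\mathrm{udr}$ and the pair $(\mathrm{udr},\mathrm{pk})$ are shuffle compatible permutation statistics. -/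

import Mathlib

namespace ShuffleCompat

/-- A permutation: a finite sequence of distinct positive integers. -/
def IsPermutation (π : List ℕ) : Prop :=
  π.Nodup ∧ ∀ x ∈ π, 0 < x

/-- `π` and `π'` have the same relative order: an order-preserving relabelling of the
entries of `π` turns `π` into `π'`. -/
def SameRelativeOrder (π π' : List ℕ) : Prop :=
  ∃ f : ℕ → ℕ, StrictMonoOn f {x | x ∈ π} ∧ π.map f = π'

/-- `St`, restricted to permutations, is a permutation statistic: its value depends only on the
relative order of the entries. (Values at lists that are not permutations play no role.) -/
def IsPermutationStatistic {α : Type*} (St : List ℕ → α) : Prop :=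
  ∀ π π' : List ℕ, IsPermutation π → IsPermutation π' → SameRelativeOrder π π' → St π = St π'

/-- The shuffle set of `π` and `σ`: the rearrangements of the letters of `π` and `σ` in which both
`π` and `σ` occur as (not necessarily contiguous) subwords. It is used for `π`, `σ` with disjoint
sets of entries. -/
def shuffles (π σ : List ℕ) : Finset (List ℕ) :=
  {τ ∈ (π ++ σ).permutations.toFinset | π.Sublist τ ∧ σ.Sublist τ}

/-- For permutations with disjoint sets of entries, the shuffles of `π` and `σ` are exactly the
permutations on the union of the two sets of entries in which `π` and `σ` occur as subwords. -/
theorem mem_shuffles {π σ τ : List ℕ} (hπ : IsPermutation π) (hσ : IsPermutation σ)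
    (hd : π.Disjoint σ) :
    τ ∈ shuffles π σ ↔ IsPermutation τ ∧ τ.toFinset = π.toFinset ∪ σ.toFinset ∧
      π.Sublist τ ∧ σ.Sublist τ := by
  have hn : (π ++ σ).Nodup := List.nodup_append'.2 ⟨hπ.1, hσ.1, hd⟩
  simp only [shuffles, Finset.mem_filter, List.mem_toFinset, List.mem_permutations]
  constructor
  · rintro ⟨hp, h1, h2⟩
    refine ⟨⟨hp.nodup_iff.2 hn, fun x hx => ?_⟩, ?_, h1, h2⟩
    · rcases List.mem_append.1 (hp.mem_iff.1 hx) with h | h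
      · exact hπ.2 x h
      · exact hσ.2 x h
    · rw [List.toFinset_eq_of_perm _ _ hp, List.toFinset_append]
  · rintro ⟨hτ, he, h1, h2⟩
    rw [← List.toFinset_append] at he
    exact ⟨List.perm_of_nodup_nodup_toFinset_eq hτ.1 hn he, h1, h2⟩

/-- The distribution of `St` over a finite set `S` of permutations: the multiset of its values. -/
def distribution {α : Type*} (St : List ℕ → α) (S : Finset (List ℕ)) : Multiset α :=
  S.val.map St

/-- `St` is a shuffle compatible permutation statistic. -/
def ShuffleCompatible {α : Type*} (St : List ℕ → α) : Prop :=
  IsPermutationStatistic St ∧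
  ∀ π π' σ σ' : List ℕ,
    IsPermutation π → IsPermutation π' → IsPermutation σ → IsPermutation σ' →
    π.length = π'.length → σ.length = σ'.length →
    π.Disjoint σ → π'.Disjoint σ' →
    St π = St π' → St σ = St σ' →
    distribution St (shuffles π σ) = distribution St (shuffles π' σ')

/-- The entry in position `i` of a word `w`, positions being `1, 2, …, w.length`. -/
def entry (w : List ℕ) (i : ℕ) : ℕ := w.getD (i - 1) 0

/-- The peak set of a word: the positions `i` with `2 ≤ i ≤ w.length - 1` and
`w_{i-1} < w_i > w_{i+1}`. -/
def Pk (w : List ℕ) : Finset ℕ :=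
  {i ∈ Finset.Icc 2 (w.length - 1) | entry w (i - 1) < entry w i ∧ entry w i > entry w (i + 1)}

/-- The peak number. -/
def pk (w : List ℕ) : ℕ := (Pk w).card

/-- The left peak number: the number of peaks of `0π`. -/
def lpk (π : List ℕ) : ℕ := pk (0 :: π)

/-- The right peak number: the number of peaks of `π0`. -/
def rpk (π : List ℕ) : ℕ := pk (π ++ [0])

/-- The exterior peak number: the number of peaks of `0π0`. -/
def epk (π : List ℕ) : ℕ := pk (0 :: (π ++ [0]))

/-- The factor `w_i … w_j` is strictly increasing or strictly decreasing. -/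
def MonotoneFactor (w : List ℕ) (i j : ℕ) : Prop :=
  (∀ k ∈ Finset.Ico i j, entry w k < entry w (k + 1)) ∨
  (∀ k ∈ Finset.Ico i j, entry w k > entry w (k + 1))

/-- The factor `w_i … w_j` (with `1 ≤ i ≤ j ≤ w.length`) is a birun of `w`: it is monotone, and it
is not properly contained in another monotone factor. -/
def IsBirun (w : List ℕ) (i j : ℕ) : Prop :=
  MonotoneFactor w i j ∧
  ∀ i' ∈ Finset.Icc 1 i, ∀ j' ∈ Finset.Icc j w.length,
    MonotoneFactor w i' j' → i' = i ∧ j' = j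

instance (w : List ℕ) (i j : ℕ) : Decidable (MonotoneFactor w i j) := by
  unfold MonotoneFactor; infer_instance

instance (w : List ℕ) (i j : ℕ) : Decidable (IsBirun w i j) := by
  unfold IsBirun; infer_instance

/-- The biruns of `w`, each given by the pair of its first and last position. -/
def biruns (w : List ℕ) : Finset (ℕ × ℕ) :=
  {p ∈ Finset.Icc 1 w.length ×ˢ Finset.Icc 1 w.length | p.1 ≤ p.2 ∧ IsBirun w p.1 p.2}

/-- The number of updown runs of `π`: the number of biruns of `0π`. -/
def udr (π : List ℕ) : ℕ := (biruns (0 :: π)).card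

end ShuffleCompat

/-! On nonempty permutations every statistic in question is a function of the numbers r = `runs true
π` and s = `runs false π` of maximal monotone runs, counted with an initial direction prescribed:
`udr` is r, `lpk` is ⌊r/2⌋, `epk` is ⌈r/2⌉, `rpk` is ⌊s/2⌋ and `pk` is ⌊(s-1)/2⌋.

Functions that are multiplicative on shuffles (shuffle characters) are closed under convolution,
because cutting a shuffle in two amounts to cutting both words and shuffling the pieces
(`shuffleSum_conv`). The indicator of monotone words is a character, since two monotone words with
distinct letters have exactly one monotone shuffle. Hence `zigzag b k` is a character. Its
generating function in k is explicit (`zigzagGF_eq`) and involves only the length and `runs b`;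
moreover `zigzag b k π` is nonzero exactly when `runs b π ≤ k`. This triangularity lets the sums of
the characters over a shuffle set recover the distribution of `runs b`.

For the halved statistics, k is restricted to one parity: the generating functions for r and r + 1
runs differ by an even or odd series, so half of the characters do not separate r from r + 1
(`zigzag_congr_of_parity`). For the pair (`udr`, `pk`), r and s differ by exactly 1 on words with at
least two letters, and such a joint distribution is determined by its marginals. -/

namespace ShuffleCompat

open Finset

/-! ### Sums over shuffles -/

/-- The sum of `φ` over all shuffles of two words, by recursion on the first letter. -/
def shuffleSum (φ : List ℕ → ℤ) : List ℕ → List ℕ → ℤ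
  | [], σ => φ σ
  | x :: π, [] => φ (x :: π)
  | x :: π, y :: σ =>
    shuffleSum (fun u => φ (x :: u)) π (y :: σ) + shuffleSum (fun u => φ (y :: u)) (x :: π) σ
  termination_by π σ => π.length + σ.length

@[simp] theorem shuffleSum_nil_left (φ : List ℕ → ℤ) (σ : List ℕ) : shuffleSum φ [] σ = φ σ := by
  simp [shuffleSum]

@[simp] theorem shuffleSum_nil_right (φ : List ℕ → ℤ) (π : List ℕ) : shuffleSum φ π [] = φ π := by
  cases π <;> simp [shuffleSum]

theorem shuffleSum_cons_cons (φ : List ℕ → ℤ) (x y : ℕ) (π σ : List ℕ) :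
    shuffleSum φ (x :: π) (y :: σ) =
      shuffleSum (fun u => φ (x :: u)) π (y :: σ) +
        shuffleSum (fun u => φ (y :: u)) (x :: π) σ := by
  rw [shuffleSum]

theorem mem_shuffles_iff {π σ τ : List ℕ} :
    τ ∈ shuffles π σ ↔ τ.Perm (π ++ σ) ∧ π.Sublist τ ∧ σ.Sublist τ := by
  simp [shuffles]

theorem shuffles_comm (π σ : List ℕ) : shuffles π σ = shuffles σ π := by
  ext τ
  rw [mem_shuffles_iff, mem_shuffles_iff]
  have h : (π ++ σ).Perm (σ ++ π) := List.perm_append_comm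
  exact ⟨fun ⟨a, b, c⟩ => ⟨a.trans h, c, b⟩, fun ⟨a, b, c⟩ => ⟨a.trans h.symm, c, b⟩⟩

theorem shuffles_nil_left (σ : List ℕ) : shuffles [] σ = {σ} := by
  ext τ
  rw [mem_shuffles_iff, mem_singleton]
  constructor
  · rintro ⟨h, -, h'⟩
    exact (h'.eq_of_length (by simpa using h.length_eq.symm)).symm
  · rintro rfl
    simp

theorem shuffles_nil_right (π : List ℕ) : shuffles π [] = {π} := by
  rw [shuffles_comm, shuffles_nil_left]

theorem cons_mem_shuffles_left {x y : ℕ} {π σ τ : List ℕ} (hxy : x ≠ y) :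
    x :: τ ∈ shuffles (x :: π) (y :: σ) ↔ τ ∈ shuffles π (y :: σ) := by
  simp only [mem_shuffles_iff, List.cons_append, List.perm_cons, List.cons_sublist_cons]
  refine and_congr_right fun _ => and_congr_right fun _ => ⟨fun h => ?_, fun h => h.cons x⟩
  cases h with
  | cons _ h => exact h
  | cons_cons _ h => exact absurd rfl hxy

/-- A shuffle must begin with one of the two leading letters. This matches the recursion of
`shuffleSum`, and distinctness of the letters ensures that the recursion counts each shuffle once.
-/
theorem shuffles_cons_cons {x y : ℕ} {π σ : List ℕ} (h : ((x :: π) ++ (y :: σ)).Nodup) :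
    shuffles (x :: π) (y :: σ) =
      (shuffles π (y :: σ)).image (List.cons x) ∪ (shuffles (x :: π) σ).image (List.cons y) := by
  have hxy : x ≠ y := by
    rintro rfl
    simp at h
  ext τ
  simp only [mem_union, mem_image]
  constructor
  · intro hτ
    cases τ with
    | nil => simp [mem_shuffles_iff] at hτ
    | cons z τ =>
      by_cases hzx : z = x
      · subst hzx
        exact Or.inl ⟨τ, (cons_mem_shuffles_left hxy).1 hτ, rfl⟩
      by_cases hzy : z = y
      · subst hzy
        rw [shuffles_comm, cons_mem_shuffles_left hxy.symm, shuffles_comm] at hτ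
        exact Or.inr ⟨τ, hτ, rfl⟩
      exfalso
      rw [mem_shuffles_iff] at hτ
      obtain ⟨hp, h1, h2⟩ := hτ
      have hn : (z :: τ).Nodup := hp.nodup_iff.2 h
      have hz : z ∈ (x :: π) ++ (y :: σ) := hp.mem_iff.1 (by simp)
      -- A subword not starting with `z` lies inside `τ`, where `z` does not recur. So a first
      -- letter other than `x` and `y` would occur in neither word.
      have key : ∀ a l, z ≠ a → (a :: l).Sublist (z :: τ) → z ∉ a :: l := by
        intro a l hza hs hm
        cases hs with
        | cons _ hs => exact (List.nodup_cons.1 hn).1 (hs.subset hm)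
        | cons_cons _ hs => exact hza rfl
      rcases List.mem_append.1 hz with hz | hz
      · exact key x π hzx h1 hz
      · exact key y σ hzy h2 hz
  · rintro (⟨τ, hτ, rfl⟩ | ⟨τ, hτ, rfl⟩)
    · exact (cons_mem_shuffles_left hxy).2 hτ
    · rw [shuffles_comm, cons_mem_shuffles_left hxy.symm, shuffles_comm]
      exact hτ

theorem sum_shuffles (φ : List ℕ → ℤ) (π σ : List ℕ) (h : (π ++ σ).Nodup) :
    ∑ τ ∈ shuffles π σ, φ τ = shuffleSum φ π σ := by
  fun_induction shuffleSum φ π σ with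
  | case1 φ σ => simp [shuffles_nil_left]
  | case2 φ x π => simp [shuffles_nil_right]
  | case3 φ x π y σ ih1 ih2 =>
    have hxy : x ≠ y := by
      rintro rfl
      simp at h
    rw [shuffles_cons_cons h, sum_union, sum_image (by simp), sum_image (by simp), ih1, ih2]
    · refine h.sublist ?_
      simp
    · simpa using (List.nodup_cons.1 h).2
    · rw [disjoint_left]
      simp only [mem_image]
      rintro _ ⟨τ, -, rfl⟩ ⟨τ', -, h'⟩
      exact hxy (List.cons.inj h').1.symm

/-! ### Convolution of functions on words -/

/-- The convolution of two functions on words, dual to deconcatenation. -/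
def conv (φ ψ : List ℕ → ℤ) (l : List ℕ) : ℤ :=
  ∑ i ∈ range (l.length + 1), φ (l.take i) * ψ (l.drop i)

theorem conv_nil (φ ψ : List ℕ → ℤ) : conv φ ψ [] = φ [] * ψ [] := by simp [conv]

theorem conv_cons (φ ψ : List ℕ → ℤ) (x : ℕ) (l : List ℕ) :
    conv φ ψ (x :: l) = φ [] * ψ (x :: l) + conv (fun u => φ (x :: u)) ψ l := by
  simp only [conv, List.length_cons]
  rw [sum_range_succ', add_comm]
  simp

/-- The convolution of two functions on pairs of words. -/
def conv₂ (Φ Ψ : List ℕ → List ℕ → ℤ) (π σ : List ℕ) : ℤ :=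
  ∑ i ∈ range (π.length + 1), ∑ j ∈ range (σ.length + 1),
    Φ (π.take i) (σ.take j) * Ψ (π.drop i) (σ.drop j)

/-- Compatibility of shuffling with deconcatenation: a cut of a shuffle of `π` and `σ` is the same
as a cut of each word together with a shuffle of the prefixes and a shuffle of the suffixes. No
distinctness is needed, since `shuffleSum` counts interleavings. The induction varies `φ`, which
absorbs the letters already read. -/
theorem shuffleSum_conv (φ ψ : List ℕ → ℤ) (π σ : List ℕ) :
    shuffleSum (conv φ ψ) π σ = conv₂ (shuffleSum φ) (shuffleSum ψ) π σ := by
  induction hn : π.length + σ.length generalizing φ π σ with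
  | zero =>
    obtain ⟨h1, h2⟩ : π = [] ∧ σ = [] := by
      simpa using hn
    subst h1 h2
    simp [conv₂, conv]
  | succ n ih =>
    match π, σ with
    | [], σ => simp [conv₂, conv]
    | x :: π, [] => simp [conv₂, conv]
    | x :: π, y :: σ =>
      have add_sum : ∀ (φ₁ φ₂ : List ℕ → ℤ) (π σ : List ℕ),
          shuffleSum (fun u => φ₁ u + φ₂ u) π σ = shuffleSum φ₁ π σ + shuffleSum φ₂ π σ := by
        intro φ₁ φ₂ π σ
        fun_induction shuffleSum φ₁ π σ generalizing φ₂ with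
        | case1 => simp
        | case2 => simp
        | case3 φ x π y σ ih1 ih2 =>
          rw [shuffleSum_cons_cons, shuffleSum_cons_cons, ih1, ih2]
          ring
      have mul_sum' : ∀ (c : ℤ) (φ₁ : List ℕ → ℤ) (π σ : List ℕ),
          shuffleSum (fun u => c * φ₁ u) π σ = c * shuffleSum φ₁ π σ := by
        intro c φ₁ π σ
        fun_induction shuffleSum φ₁ π σ with
        | case1 => simp
        | case2 => simp
        | case3 φ x π y σ ih1 ih2 =>
          rw [shuffleSum_cons_cons, ih1, ih2]
          ring
      rw [shuffleSum_cons_cons]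
      simp only [conv_cons]
      rw [add_sum, add_sum, mul_sum', mul_sum',
        ih _ _ _ (by simp at hn ⊢; omega), ih _ _ _ (by simp at hn ⊢; omega)]
      simp only [conv₂, List.length_cons]
      -- Separating the cuts with an empty prefix leaves pairs of nonempty prefixes, to which the
      -- first-letter recursion applies.
      rw [sum_range_succ' _ (π.length + 1), sum_range_succ' _ (π.length + 1)]
      simp only [sum_range_succ' _ (σ.length + 1)]
      simp only [List.take_succ_cons, List.drop_succ_cons, List.take_zero, List.drop_zero,
        shuffleSum_cons_cons, shuffleSum_nil_left, shuffleSum_nil_right, add_mul,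
        sum_add_distrib, mul_add]
      ring

/-- A function on words is a shuffle character if its sum over the shuffles of two words without
common letters is the product of its values. -/
def IsShuffleCharacter (φ : List ℕ → ℤ) : Prop :=
  ∀ π σ : List ℕ, (π ++ σ).Nodup → shuffleSum φ π σ = φ π * φ σ

theorem IsShuffleCharacter.conv {φ ψ : List ℕ → ℤ} (hφ : IsShuffleCharacter φ)
    (hψ : IsShuffleCharacter ψ) : IsShuffleCharacter (conv φ ψ) := by
  intro π σ h
  rw [shuffleSum_conv, conv₂, ShuffleCompat.conv, ShuffleCompat.conv, sum_mul_sum]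
  refine sum_congr rfl fun i _ => sum_congr rfl fun j _ => ?_
  rw [hφ, hψ]
  · ring
  · exact h.sublist ((List.drop_sublist i π).append (List.drop_sublist j σ))
  · exact h.sublist ((List.take_sublist i π).append (List.take_sublist j σ))

/-! ### A criterion for shuffle compatibility -/

/-- Triangular elimination on the fibres of `st`: in the sum of `F k`, fibres above `k` vanish,
fibres below `k` agree by induction, and fibre `k` contributes its cardinality times a nonzero
constant. -/
theorem eq_of_triangular_sums {ι : Type*} [DecidableEq ι] {S S' : Finset ι} (st : ι → ℕ) (F : ℕ → ι → ℤ)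
    (hcongr : ∀ k, ∀ a ∈ S ∪ S', ∀ b ∈ S ∪ S', st a = st b → F k a = F k b)
    (hzero : ∀ k, ∀ a ∈ S ∪ S', k < st a → F k a = 0)
    (hne : ∀ a ∈ S ∪ S', F (st a) a ≠ 0)
    (hsum : ∀ k, ∑ a ∈ S, F k a = ∑ a ∈ S', F k a) :
    S.val.map st = S'.val.map st := by
  have hcard : ∀ k, #{a ∈ S | st a = k} = #{a ∈ S' | st a = k} := by
    intro k
    induction k using Nat.strong_induction_on with
    | _ k ih =>
    by_cases hk : ∃ a ∈ S ∪ S', st a = k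
    swap
    · push Not at hk
      rw [filter_false_of_mem, filter_false_of_mem]
      · exact fun a ha => hk a (mem_union_right _ ha)
      · exact fun a ha => hk a (mem_union_left _ ha)
    obtain ⟨a₀, ha₀, rfl⟩ := hk
    have expand : ∀ T ⊆ S ∪ S', ∑ a ∈ T, F (st a₀) a =
        ∑ j ∈ range (st a₀), ∑ a ∈ T with st a = j, F (st a₀) a +
          #{a ∈ T | st a = st a₀} * F (st a₀) a₀ := by
      intro T hT
      have h1 : ∑ a ∈ T with st a = st a₀, F (st a₀) a =
          #{a ∈ T | st a = st a₀} * F (st a₀) a₀ := by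
        rw [← nsmul_eq_mul, ← sum_const]
        refine sum_congr rfl fun a ha => ?_
        rw [mem_filter] at ha
        exact hcongr _ _ (hT ha.1) _ ha₀ ha.2
      rw [← h1, ← sum_range_succ (fun j => ∑ a ∈ T with st a = j, F (st a₀) a),
        sum_fiberwise_eq_sum_filter, sum_filter]
      refine sum_congr rfl fun a ha => ?_
      split_ifs with h
      · rfl
      · exact hzero _ _ (hT ha) (by simpa using h)
    have hlow : ∑ j ∈ range (st a₀), ∑ a ∈ S with st a = j, F (st a₀) a =
        ∑ j ∈ range (st a₀), ∑ a ∈ S' with st a = j, F (st a₀) a := by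
      refine sum_congr rfl fun j hj => ?_
      by_cases hj' : ∃ b ∈ S ∪ S', st b = j
      · obtain ⟨b, hb, rfl⟩ := hj'
        have : ∀ T ⊆ S ∪ S', ∑ a ∈ T with st a = st b, F (st a₀) a =
            #{a ∈ T | st a = st b} * F (st a₀) b := by
          intro T hT
          rw [← nsmul_eq_mul, ← sum_const]
          refine sum_congr rfl fun a ha => ?_
          rw [mem_filter] at ha
          exact hcongr _ _ (hT ha.1) _ hb ha.2
        rw [this S subset_union_left, this S' subset_union_right, ih _ (mem_range.1 hj)]
      · push Not at hj'
        rw [filter_false_of_mem, filter_false_of_mem]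
        · exact fun a ha => hj' a (mem_union_right _ ha)
        · exact fun a ha => hj' a (mem_union_left _ ha)
    have := hsum (st a₀)
    rw [expand S subset_union_left, expand S' subset_union_right, hlow] at this
    exact_mod_cast mul_right_cancel₀ (hne a₀ ha₀) (add_left_cancel this)
  ext k
  rw [Multiset.count_map, Multiset.count_map]
  simpa [eq_comm, Finset.card] using hcard k

theorem isPermutation_of_mem_shuffles {π σ τ : List ℕ} (hπ : IsPermutation π)
    (hσ : IsPermutation σ) (hd : π.Disjoint σ) (hτ : τ ∈ shuffles π σ) : IsPermutation τ :=
  ((mem_shuffles hπ hσ hd).1 hτ).1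

theorem length_of_mem_shuffles {π σ τ : List ℕ} (hτ : τ ∈ shuffles π σ) :
    τ.length = π.length + σ.length := by
  simpa using (mem_shuffles_iff.1 hτ).1.length_eq

/-- It suffices to compare distributions over the shuffles of nonempty permutations. -/
theorem shuffleCompatible_of_nonempty {α : Type*} {St : List ℕ → α}
    (hSt : IsPermutationStatistic St)
    (h : ∀ π π' σ σ' : List ℕ,
      IsPermutation π → IsPermutation π' → IsPermutation σ → IsPermutation σ' →
      π ≠ [] → π' ≠ [] → σ ≠ [] → σ' ≠ [] →
      π.length = π'.length → σ.length = σ'.length →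
      π.Disjoint σ → π'.Disjoint σ' →
      St π = St π' → St σ = St σ' →
      distribution St (shuffles π σ) = distribution St (shuffles π' σ')) :
    ShuffleCompatible St := by
  refine ⟨hSt, fun π π' σ σ' hπ hπ' hσ hσ' hl1 hl2 hd hd' h1 h2 => ?_⟩
  -- The empty word has to be set apart because triangularity fails there: `zigzag b 0 []` is 1
  -- although `runs b []` is 1.
  by_cases hπ0 : π = []
  · obtain rfl : π' = [] := by simpa [hπ0] using hl1.symm
    subst hπ0
    simp [shuffles_nil_left, distribution, h2]
  by_cases hσ0 : σ = []
  · obtain rfl : σ' = [] := by simpa [hσ0] using hl2.symm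
    subst hσ0
    simp [shuffles_nil_right, distribution, h1]
  refine h π π' σ σ' hπ hπ' hσ hσ' hπ0 ?_ hσ0 ?_ hl1 hl2 hd hd' h1 h2
  · rintro rfl
    simp at hl1
    exact hπ0 hl1
  · rintro rfl
    simp at hl2
    exact hσ0 hl2

/-- A statistic is shuffle compatible if there is a family of shuffle characters that depend only
on the statistic and the length, and do so in a triangular way. -/
theorem shuffleCompatible_of_characters {St : List ℕ → ℕ} (hSt : IsPermutationStatistic St)
    (F : ℕ → List ℕ → ℤ) (hF : ∀ k, IsShuffleCharacter (F k))
    (hcongr : ∀ k π π', IsPermutation π → IsPermutation π' → π ≠ [] → π' ≠ [] →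
      π.length = π'.length → St π = St π' → F k π = F k π')
    (hzero : ∀ k π, IsPermutation π → π ≠ [] → k < St π → F k π = 0)
    (hne : ∀ π, IsPermutation π → π ≠ [] → F (St π) π ≠ 0) :
    ShuffleCompatible St := by
  refine shuffleCompatible_of_nonempty hSt fun π π' σ σ' hπ hπ' hσ hσ' hπ0 hπ'0 hσ0 hσ'0
    hl1 hl2 hd hd' h1 h2 => ?_
  have hpos : 0 < π.length := List.length_pos_iff.2 hπ0
  have hall : ∀ τ ∈ shuffles π σ ∪ shuffles π' σ',
      IsPermutation τ ∧ τ ≠ [] ∧ τ.length = π.length + σ.length := by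
    intro τ hτ
    have hl : τ.length = π.length + σ.length := by
      rcases mem_union.1 hτ with hτ | hτ
      · exact length_of_mem_shuffles hτ
      · rw [length_of_mem_shuffles hτ, hl1, hl2]
    refine ⟨?_, ?_, hl⟩
    · rcases mem_union.1 hτ with hτ | hτ
      · exact isPermutation_of_mem_shuffles hπ hσ hd hτ
      · exact isPermutation_of_mem_shuffles hπ' hσ' hd' hτ
    · rintro rfl
      simp at hl
      omega
  refine eq_of_triangular_sums St F ?_ ?_ ?_ ?_
  · intro k a ha b hb hab
    obtain ⟨ha1, ha2, ha3⟩ := hall a ha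
    obtain ⟨hb1, hb2, hb3⟩ := hall b hb
    exact hcongr k a b ha1 hb1 ha2 hb2 (ha3.trans hb3.symm) hab
  · exact fun k a ha => hzero k a (hall a ha).1 (hall a ha).2.1
  · exact fun a ha => hne a (hall a ha).1 (hall a ha).2.1
  · intro k
    have hn : (π ++ σ).Nodup := List.nodup_append'.2 ⟨hπ.1, hσ.1, hd⟩
    have hn' : (π' ++ σ').Nodup := List.nodup_append'.2 ⟨hπ'.1, hσ'.1, hd'⟩
    rw [sum_shuffles _ _ _ hn, sum_shuffles _ _ _ hn', hF k _ _ hn, hF k _ _ hn',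
      hcongr k π π' hπ hπ' hπ0 hπ'0 hl1 h1, hcongr k σ σ' hσ hσ' hσ0 hσ'0 hl2 h2]

/-- Two multisets of pairs of numbers differing by `1` agree if their marginals agree. -/
theorem multiset_eq_of_marginals {M M' : Multiset (ℕ × ℕ)}
    (hM : ∀ p ∈ M, p.2 = p.1 + 1 ∨ p.1 = p.2 + 1)
    (hM' : ∀ p ∈ M', p.2 = p.1 + 1 ∨ p.1 = p.2 + 1)
    (h1 : M.map Prod.fst = M'.map Prod.fst) (h2 : M.map Prod.snd = M'.map Prod.snd) :
    M = M' := by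
  have c1 : ∀ N : Multiset (ℕ × ℕ), (∀ p ∈ N, p.2 = p.1 + 1 ∨ p.1 = p.2 + 1) → ∀ a,
      (N.map Prod.fst).count (a + 1) = N.count (a + 1, a + 2) + N.count (a + 1, a) ∧
      (N.map Prod.snd).count (a + 1) = N.count (a + 2, a + 1) + N.count (a, a + 1) ∧
      (N.map Prod.fst).count 0 = N.count (0, 1) ∧
      (N.map Prod.snd).count 0 = N.count (1, 0) := by
    intro N hN a
    induction N using Multiset.induction_on with
    | empty => simp
    | cons p N ih =>
      obtain ⟨i1, i2, i3, i4⟩ := ih fun q hq => hN q (Multiset.mem_cons_of_mem hq)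
      have hp := hN p (Multiset.mem_cons_self p N)
      obtain ⟨p, q⟩ := p
      simp only [Multiset.map_cons, Multiset.count_cons, Prod.mk.injEq] at hp ⊢
      rw [i1, i2, i3, i4]
      clear i1 i2 i3 i4 hN h1 h2 hM hM'
      refine ⟨?_, ?_, ?_, ?_⟩
      · have : (if a + 1 = p then 1 else 0) = (if a + 1 = p ∧ a + 2 = q then 1 else 0) +
            if a + 1 = p ∧ a = q then 1 else 0 := by
          split_ifs <;> omega
        omega
      · have : (if a + 1 = q then 1 else 0) = (if a + 2 = p ∧ a + 1 = q then 1 else 0) +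
            if a = p ∧ a + 1 = q then 1 else 0 := by
          split_ifs <;> omega
        omega
      · have : (if 0 = p then 1 else 0) = if 0 = p ∧ 1 = q then 1 else 0 := by
          split_ifs <;> omega
        omega
      · have : (if 0 = q then 1 else 0) = if 1 = p ∧ 0 = q then 1 else 0 := by
          split_ifs <;> omega
        omega
  -- The value 0 of either coordinate forces the other to be 1. Thereafter each marginal count at `a
  -- + 1` involves one multiplicity already known and one new one.
  have key : ∀ a, M.count (a, a + 1) = M'.count (a, a + 1) ∧
      M.count (a + 1, a) = M'.count (a + 1, a) := by
    intro a
    induction a with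
    | zero =>
      have e1 := c1 M hM 0
      have e2 := c1 M' hM' 0
      rw [h1, h2] at e1
      simp only [zero_add] at e1 e2 ⊢
      omega
    | succ a ih =>
      have e1 := c1 M hM a
      have e2 := c1 M' hM' a
      rw [h1, h2] at e1
      simp only [add_assoc, Nat.reduceAdd] at e1 e2 ⊢
      omega
  ext ⟨a, b⟩
  by_cases h : b = a + 1 ∨ a = b + 1
  · rcases h with rfl | rfl
    · exact (key a).1
    · exact (key b).2
  · rw [Multiset.count_eq_zero_of_notMem fun h' => h (hM _ h'),
      Multiset.count_eq_zero_of_notMem fun h' => h (hM' _ h')]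

/-! ### Runs and factorizations into monotone words -/

/-- The number of maximal monotone runs of a word, where `b` is the direction in which its first
letter is entered (`true` for an ascent). -/
def runs : Bool → List ℕ → ℕ
  | _, [] => 1
  | _, [_] => 1
  | b, x :: y :: l => if decide (x < y) = b then runs b (y :: l) else runs (!b) (y :: l) + 1

/-- The indicator of increasing (`b = true`) or weakly decreasing (`b = false`) words. -/
def mono (b : Bool) (l : List ℕ) : ℤ :=
  if l.Pairwise (fun x y => decide (x < y) = b) then 1 else 0

theorem dir_trans {b : Bool} {x y z : ℕ} (h1 : decide (x < y) = b) (h2 : decide (y < z) = b) :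
    decide (x < z) = b := by
  cases b
  · simp at *
    omega
  · simp at *
    omega

theorem mono_cons (b : Bool) (x : ℕ) (l : List ℕ) :
    mono b (x :: l) = if ∀ z ∈ l, decide (x < z) = b then mono b l else 0 := by
  simp only [mono, List.pairwise_cons]
  split_ifs <;> tauto

theorem mono_cons_cons (b : Bool) (x y : ℕ) (l : List ℕ) :
    mono b (x :: y :: l) = if decide (x < y) = b then mono b (y :: l) else 0 := by
  rw [mono_cons]
  by_cases h : decide (x < y) = b
  · rw [if_pos h]
    split_ifs with h1
    · rfl
    · rw [mono_cons, if_neg]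
      intro h2
      refine h1 fun z hz => ?_
      rcases List.mem_cons.1 hz with rfl | hz
      · exact h
      · exact dir_trans h (h2 z hz)
  · rw [if_neg h, if_neg]
    intro h'
    exact h (h' y (by simp))

theorem shuffleSum_zero (π σ : List ℕ) : shuffleSum (fun _ => 0) π σ = 0 := by
  induction hn : π.length + σ.length generalizing π σ with
  | zero =>
    obtain ⟨rfl, rfl⟩ : π = [] ∧ σ = [] := by simpa using hn
    simp
  | succ n ih =>
    match π, σ with
    | [], σ => simp
    | x :: π, [] => simp
    | x :: π, y :: σ =>
      rw [shuffleSum_cons_cons, ih _ _ (by simp at hn ⊢; omega), ih _ _ (by simp at hn ⊢; omega),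
        add_zero]

/-- The condition depends only on the set of letters, which is the same for all shuffles, so it can
be pulled out of the sum. -/
theorem shuffleSum_ite_forall (p : ℕ → Prop) [DecidablePred p] (φ : List ℕ → ℤ) (π σ : List ℕ) :
    shuffleSum (fun u => if ∀ z ∈ u, p z then φ u else 0) π σ =
      if ∀ z ∈ π ++ σ, p z then shuffleSum φ π σ else 0 := by
  fun_induction shuffleSum φ π σ with
  | case1 => simp
  | case2 => simp
  | case3 φ x π y σ ih1 ih2 =>
    have key : ∀ x : ℕ, (fun u => if ∀ z ∈ x :: u, p z then φ (x :: u) else 0) =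
        if p x then fun u => if ∀ z ∈ u, p z then φ (x :: u) else 0 else fun _ => 0 := by
      intro x
      funext u
      by_cases hx : p x <;> simp [hx]
    rw [shuffleSum_cons_cons, key, key]
    by_cases hx : p x
    · by_cases hy : p y
      · rw [if_pos hx, if_pos hy, ih1, ih2]
        have e1 : (∀ z ∈ π ++ y :: σ, p z) ↔ ∀ z ∈ x :: π ++ y :: σ, p z := by simp [hx]
        have e2 : (∀ z ∈ x :: π ++ σ, p z) ↔ ∀ z ∈ x :: π ++ y :: σ, p z := by
          simp only [List.mem_append, List.mem_cons]
          constructor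
          · rintro h z (h' | rfl | h')
            · exact h z (.inl h')
            · exact hy
            · exact h z (.inr h')
          · rintro h z (h' | h')
            · exact h z (.inl h')
            · exact h z (.inr (.inr h'))
        simp only [e1, e2]
        split_ifs <;> simp
      · have e0 : ¬ ∀ z ∈ x :: π ++ y :: σ, p z := fun h => hy (h y (by simp))
        have e1 : ¬ ∀ z ∈ π ++ y :: σ, p z := fun h => hy (h y (by simp))
        rw [if_pos hx, if_neg hy, ih1, if_neg e0, if_neg e1, shuffleSum_zero, add_zero]
    · have e0 : ¬ ∀ z ∈ x :: π ++ y :: σ, p z := fun h => hx (h x (by simp))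
      have e1 : ¬ ∀ z ∈ x :: π ++ σ, p z := fun h => hx (h x (by simp))
      rw [if_neg hx, shuffleSum_zero, if_neg e0, zero_add]
      split_ifs
      · rw [ih2, if_neg e1]
      · rw [shuffleSum_zero]

/-- A monotone shuffle must start with the extreme letter in direction `b`, so of the two branches
of the recursion only one can contribute. -/
theorem isShuffleCharacter_mono (b : Bool) : IsShuffleCharacter (mono b) := by
  intro π σ h
  induction hn : π.length + σ.length generalizing π σ with
  | zero =>
    obtain ⟨rfl, rfl⟩ : π = [] ∧ σ = [] := by simpa using hn
    simp [mono]
  | succ n ih =>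
    match π, σ with
    | [], σ => simp [mono]
    | x :: π, [] => simp [mono]
    | x :: π, y :: σ =>
      have hxy : x ≠ y := by
        rintro rfl
        simp at h
      rw [shuffleSum_cons_cons]
      simp only [mono_cons b x, mono_cons b y]
      rw [shuffleSum_ite_forall, shuffleSum_ite_forall,
        ih _ _ (by simpa using (List.nodup_cons.1 h).2) (by simp at hn ⊢; omega),
        ih _ _ (h.sublist (by simp)) (by simp at hn ⊢; omega), mono_cons b x, mono_cons b y]
      have hor : (decide (x < y) = b ∧ ¬ decide (y < x) = b) ∨
          (decide (y < x) = b ∧ ¬ decide (x < y) = b) := by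
        cases b <;> simp <;> omega
      by_cases hx : ∀ z ∈ π, decide (x < z) = b
      swap
      · have e : ¬ ∀ z ∈ π ++ y :: σ, decide (x < z) = b :=
          fun h => hx fun z hz => h z (by simp [hz])
        rw [if_neg hx, if_neg e]
        simp
      by_cases hy : ∀ z ∈ σ, decide (y < z) = b
      swap
      · have e : ¬ ∀ z ∈ x :: π ++ σ, decide (y < z) = b :=
          fun h => hy fun z hz => h z (by simp [hz])
        rw [if_neg hy, if_neg e]
        simp
      rw [if_pos hx, if_pos hy]
      rcases hor with ⟨h1, h2⟩ | ⟨h1, h2⟩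
      · have e1 : ∀ z ∈ π ++ y :: σ, decide (x < z) = b := by
          simp only [List.mem_append, List.mem_cons]
          rintro z (hz | rfl | hz)
          · exact hx z hz
          · exact h1
          · exact dir_trans h1 (hy z hz)
        have e2 : ¬ ∀ z ∈ x :: π ++ σ, decide (y < z) = b := fun h => h2 (h x (by simp))
        rw [if_pos e1, if_neg e2, add_zero]
      · have e1 : ∀ z ∈ x :: π ++ σ, decide (y < z) = b := by
          simp only [List.mem_append, List.mem_cons]
          rintro z ((rfl | hz) | hz)
          · exact h1
          · exact dir_trans h1 (hx z hz)
          · exact hy z hz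
        have e2 : ¬ ∀ z ∈ π ++ y :: σ, decide (x < z) = b := fun h => h2 (h y (by simp))
        rw [if_pos e1, if_neg e2, zero_add]

/-- The number of factorizations of a word into `k` possibly empty monotone factors of alternating
directions, the first of which has direction `b`. -/
def zigzag : Bool → ℕ → List ℕ → ℤ
  | _, 0 => fun l => if l = [] then 1 else 0
  | b, k + 1 => conv (mono b) (zigzag (!b) k)

theorem isShuffleCharacter_zigzag (b : Bool) (k : ℕ) : IsShuffleCharacter (zigzag b k) := by
  induction k generalizing b with
  | zero =>
    intro π σ _
    match π, σ with
    | [], σ => simp [zigzag]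
    | x :: π, [] => simp [zigzag]
    | x :: π, y :: σ => simp [zigzag, shuffleSum_cons_cons, shuffleSum_zero]
  | succ k ih => exact (isShuffleCharacter_mono b).conv (ih _)

theorem zigzag_zero_cons (b : Bool) (x : ℕ) (l : List ℕ) : zigzag b 0 (x :: l) = 0 := by
  simp [zigzag]

theorem zigzag_nil (b : Bool) (k : ℕ) : zigzag b k [] = 1 := by
  induction k generalizing b with
  | zero => simp [zigzag]
  | succ k ih => simp [zigzag, conv_nil, ih, mono]

theorem zigzag_singleton (b : Bool) (k x : ℕ) : zigzag b k [x] = k := by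
  induction k generalizing b with
  | zero => simp [zigzag]
  | succ k ih => simp [zigzag, conv_cons, conv_nil, ih, mono, zigzag_nil]

/-- Either the first factor is empty, or it contains `x`. In the latter case, if the step from `x`
to `y` has direction `b`, deleting `x` is a bijection onto factorizations of the rest; otherwise the
first factor is `[x]` alone. -/
theorem zigzag_succ_cons_cons (b : Bool) (k x y : ℕ) (l : List ℕ) :
    zigzag b (k + 1) (x :: y :: l) = zigzag (!b) k (x :: y :: l) +
      if decide (x < y) = b then zigzag b (k + 1) (y :: l) else zigzag (!b) k (y :: l) := by
  have h0 : mono b [] = 1 := by simp [mono]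
  have h1 : mono b [x] = 1 := by simp [mono]
  simp only [zigzag, conv_cons, mono_cons_cons, h0, h1, one_mul]
  congr 1
  split_ifs
  · rfl
  · simp [conv]

theorem one_le_runs (b : Bool) (l : List ℕ) : 1 ≤ runs b l := by
  fun_induction runs b l <;> omega

theorem runs_le_length (b : Bool) (x : ℕ) (l : List ℕ) : runs b (x :: l) ≤ l.length + 1 := by
  induction l generalizing b x with
  | nil => simp [runs]
  | cons y l ih =>
    have h1 := ih b y
    have h2 := ih (!b) y
    rw [runs, List.length_cons]
    split_ifs <;> omega

theorem zigzag_nonneg (b : Bool) (k : ℕ) (l : List ℕ) : 0 ≤ zigzag b k l := by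
  induction k generalizing b l with
  | zero => simp only [zigzag]; split_ifs <;> simp
  | succ k ih =>
    rw [zigzag, conv]
    refine sum_nonneg fun i _ => mul_nonneg ?_ (ih _ _)
    simp only [mono]
    split_ifs <;> simp

/-- The runs form a shortest alternating factorization, and empty factors may be appended. Formally,
the recursion has nonnegative terms, so its positivity is that of one of them. -/
theorem zigzag_pos_iff (b : Bool) (k x : ℕ) (l : List ℕ) :
    0 < zigzag b k (x :: l) ↔ runs b (x :: l) ≤ k := by
  induction l generalizing b k x with
  | nil => simp [zigzag_singleton, runs, Nat.one_le_iff_ne_zero, Nat.pos_iff_ne_zero]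
  | cons y l ih =>
    induction k generalizing b with
    | zero =>
      have := one_le_runs b (x :: y :: l)
      simp only [zigzag_zero_cons, lt_self_iff_false, false_iff]
      omega
    | succ k ihk =>
      have e1 := ihk (!b)
      have e2 := ih b (k + 1) y
      have e3 := ih (!b) k y
      have n1 := zigzag_nonneg (!b) k (x :: y :: l)
      have n2 := zigzag_nonneg b (k + 1) (y :: l)
      have n3 := zigzag_nonneg (!b) k (y :: l)
      rw [zigzag_succ_cons_cons]
      by_cases h : decide (x < y) = b
      · have h' : ¬ decide (x < y) = !b := by simp [h]
        rw [runs, if_neg h', Bool.not_not] at e1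
        rw [runs, if_pos h, if_pos h]
        omega
      · have h' : decide (x < y) = !b := Bool.eq_not.2 h
        rw [runs, if_pos h'] at e1
        rw [runs, if_neg h, if_neg h]
        omega

/-! ### Generating functions -/

open PowerSeries in
/-- The generating function of the numbers of factorizations into alternating factors. -/
noncomputable def zigzagGF (b : Bool) (l : List ℕ) : PowerSeries ℤ :=
  PowerSeries.mk fun k => zigzag b k l

open PowerSeries in
theorem zigzagGF_singleton (b : Bool) (x : ℕ) : (1 - X) ^ 2 * zigzagGF b [x] = X := by
  have h : zigzagGF b [x] = X * zigzagGF b [x] + X * PowerSeries.mk (fun _ => (1 : ℤ)) := by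
    ext k
    cases k with
    | zero => simp [zigzagGF, zigzag_singleton]
    | succ k => simp [zigzagGF, zigzag_singleton, coeff_succ_X_mul]
  have h1 : PowerSeries.mk (fun _ => (1 : ℤ)) * (1 - X) = 1 := mk_one_mul_one_sub_eq_one ℤ
  linear_combination (1 - X) * h + X * h1

open PowerSeries in
theorem zigzagGF_cons_cons (b : Bool) (x y : ℕ) (l : List ℕ) :
    zigzagGF b (x :: y :: l) = X * zigzagGF (!b) (x :: y :: l) +
      if decide (x < y) = b then zigzagGF b (y :: l) else X * zigzagGF (!b) (y :: l) := by
  ext k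
  cases k with
  | zero => split_ifs <;> simp [zigzagGF, zigzag_zero_cons]
  | succ k =>
    split_ifs with h <;> simp [zigzagGF, zigzag_succ_cons_cons, coeff_succ_X_mul, h]

open PowerSeries in
-- Eliminating the series of opposite direction from the two recursions shows that each further
-- letter multiplies the series by (1 + X²)/(1 - X²) if it continues a run and by 2X/(1 - X²) if it
-- starts a new one. A single letter gives X/(1 - X)².
theorem zigzagGF_eq (b : Bool) (x : ℕ) (l : List ℕ) :
    (1 - X) ^ 2 * (1 - X ^ 2) ^ l.length * zigzagGF b (x :: l) =
      X * (1 + X ^ 2) ^ (l.length + 1 - runs b (x :: l)) * (2 * X) ^ (runs b (x :: l) - 1) := by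
  induction l generalizing b x with
  | nil => simpa [runs] using zigzagGF_singleton b x
  | cons y l ih =>
    have e1 := zigzagGF_cons_cons b x y l
    have e2 := zigzagGF_cons_cons (!b) x y l
    rw [Bool.not_not] at e2
    by_cases h : decide (x < y) = b
    · have h' : ¬ decide (x < y) = !b := by simp [h]
      have hle := runs_le_length b y l
      have hrec := ih b y
      rw [if_pos h] at e1
      rw [if_neg h'] at e2
      rw [runs, if_pos h, List.length_cons,
        show l.length + 1 + 1 - runs b (y :: l) = (l.length + 1 - runs b (y :: l)) + 1 by omega]
      linear_combination (1 - X) ^ 2 * (1 - X ^ 2) ^ l.length * (e1 + X * e2)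
        + (1 + X ^ 2) * hrec
    · have h' : decide (x < y) = !b := Bool.eq_not.2 h
      have hle := runs_le_length (!b) y l
      have hpos := one_le_runs (!b) (y :: l)
      have hrec := ih (!b) y
      rw [if_neg h] at e1
      rw [if_pos h'] at e2
      rw [runs, if_neg h, List.length_cons, Nat.add_sub_add_right, Nat.add_sub_cancel]
      obtain ⟨r, hr⟩ : ∃ r, runs (!b) (y :: l) = r + 1 := ⟨_, (Nat.sub_add_cancel hpos).symm⟩
      rw [hr] at hrec ⊢
      rw [Nat.add_sub_cancel] at hrec
      linear_combination (1 - X) ^ 2 * (1 - X ^ 2) ^ l.length * (e1 + X * e2)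
        + (2 * X) * hrec

open PowerSeries in
theorem one_sub_X_pow_ne_zero (n m : ℕ) (hm : m ≠ 0) : (1 - X ^ m : PowerSeries ℤ) ^ n ≠ 0 := by
  refine pow_ne_zero _ fun h => ?_
  have := congrArg constantCoeff h
  simp [hm] at this

theorem zigzag_congr {b : Bool} {π π' : List ℕ} (hπ : π ≠ []) (hπ' : π' ≠ [])
    (hl : π.length = π'.length) (hr : runs b π = runs b π') (k : ℕ) :
    zigzag b k π = zigzag b k π' := by
  match π, π' with
  | x :: l, y :: l' =>
    have hl : l.length = l'.length := by simpa using hl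
    have e1 := zigzagGF_eq b x l
    have e2 := zigzagGF_eq b y l'
    rw [hl, hr, ← e2] at e1
    have hne := mul_ne_zero (one_sub_X_pow_ne_zero 2 1 one_ne_zero)
      (one_sub_X_pow_ne_zero l'.length 2 two_ne_zero)
    rw [pow_one] at hne
    have := mul_left_cancel₀ hne e1
    simpa [zigzagGF] using congrArg (PowerSeries.coeff k) this

/-- The difference of the two series contains the factor (1 + X²) - 2X = (1 - X)², which cancels the
only part of the denominator that is not even. What remains has the parity of `runs b π`, so its
coefficients of the other parity vanish. -/
theorem zigzag_congr_of_parity {b : Bool} {π π' : List ℕ} (hπ : π ≠ []) (hπ' : π' ≠ [])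
    (hl : π.length = π'.length) (hr : runs b π' = runs b π + 1) {k : ℕ}
    (hk : Odd (k + runs b π)) : zigzag b k π = zigzag b k π' := by
  match π, π' with
  | x :: l, y :: l' =>
    have hl : l.length = l'.length := by simpa using hl
    have e1 := zigzagGF_eq b x l
    have e2 := zigzagGF_eq b y l'
    have hle := runs_le_length b y l'
    obtain ⟨r, hr1⟩ : ∃ r, runs b (x :: l) = r + 1 :=
      ⟨_, (Nat.sub_add_cancel (one_le_runs b _)).symm⟩
    rw [hr1] at hr e1 hk
    rw [hr] at e2 hle
    rw [hl] at e1
    obtain ⟨s, hs⟩ : ∃ s, l'.length = r + 1 + s := ⟨l'.length - (r + 1), by omega⟩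
    rw [show l'.length + 1 - (r + 1) = s + 1 by omega, Nat.add_sub_cancel] at e1
    rw [show l'.length + 1 - (r + 1 + 1) = s by omega, Nat.add_sub_cancel] at e2
    set D := zigzagGF b (x :: l) - zigzagGF b (y :: l') with hD
    have hne := one_sub_X_pow_ne_zero 2 1 one_ne_zero
    rw [pow_one] at hne
    have e3 : (1 - PowerSeries.X ^ 2) ^ l'.length * D =
        PowerSeries.X * (1 + PowerSeries.X ^ 2) ^ s * (2 * PowerSeries.X) ^ r := by
      refine mul_left_cancel₀ hne ?_
      rw [hD]
      linear_combination e1 - e2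
    -- Substituting -X for X exhibits `D` as even or odd.
    have e4 := congrArg (PowerSeries.evalNegHom (A := ℤ)) e3
    simp only [map_mul, map_pow, map_sub, map_add, map_one, map_ofNat,
      PowerSeries.evalNegHom_X, neg_sq] at e4
    have e5 : PowerSeries.evalNegHom D = (-1) ^ (r + 1) * D := by
      refine mul_left_cancel₀ (one_sub_X_pow_ne_zero l'.length 2 two_ne_zero) ?_
      rw [e4, mul_left_comm, e3, show (2 * -PowerSeries.X : PowerSeries ℤ) =
        (-1) * (2 * PowerSeries.X) by ring, mul_pow]
      ring
    have e6 := congrArg (PowerSeries.coeff k) e5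
    have e7 : ((-1) ^ (r + 1) * D : PowerSeries ℤ) = ((-1 : ℤ) ^ (r + 1)) • D := by
      rw [zsmul_eq_mul]
      push_cast
      rfl
    rw [e7, PowerSeries.evalNegHom, PowerSeries.coeff_rescale, map_zsmul, smul_eq_mul] at e6
    have e8 : PowerSeries.coeff k D = 0 := by
      rcases neg_one_pow_eq_or ℤ k with h | h <;> rcases neg_one_pow_eq_or ℤ (r + 1) with h' | h'
      · exfalso
        have := hk.neg_one_pow (α := ℤ)
        rw [pow_add, h, h'] at this
        norm_num at this
      · rw [h, h'] at e6
        simp at e6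
        omega
      · rw [h, h'] at e6
        simp at e6
        omega
      · exfalso
        have := hk.neg_one_pow (α := ℤ)
        rw [pow_add, h, h'] at this
        norm_num at this
    simpa [hD, zigzagGF, sub_eq_zero] using e8

theorem zigzag_congr_of_succ_or_eq {b : Bool} {π π' : List ℕ} (hπ : π ≠ []) (hπ' : π' ≠ [])
    (hl : π.length = π'.length) {k : ℕ}
    (hr : (k + runs b π + 1) / 2 = (k + runs b π' + 1) / 2) :
    zigzag b k π = zigzag b k π' := by
  rcases lt_trichotomy (runs b π) (runs b π') with h | h | h
  · refine zigzag_congr_of_parity hπ hπ' hl (by omega) ?_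
    rw [Nat.odd_iff]
    omega
  · exact zigzag_congr hπ hπ' hl h k
  · refine (zigzag_congr_of_parity hπ' hπ hl.symm (by omega) ?_).symm
    rw [Nat.odd_iff]
    omega

theorem zigzag_eq_zero {b : Bool} {k : ℕ} {π : List ℕ} (hπ : π ≠ []) (h : k < runs b π) :
    zigzag b k π = 0 := by
  match π with
  | x :: l =>
    have h1 := zigzag_pos_iff b k x l
    have h2 := zigzag_nonneg b k (x :: l)
    omega

theorem zigzag_ne_zero {b : Bool} {k : ℕ} {π : List ℕ} (hπ : π ≠ []) (h : runs b π ≤ k) :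
    zigzag b k π ≠ 0 := by
  match π with
  | x :: l => exact ((zigzag_pos_iff b k x l).2 h).ne'

/-! ### Peaks and biruns of words -/

theorem entry_cons_succ (x : ℕ) (w : List ℕ) {i : ℕ} (hi : 1 ≤ i) :
    entry (x :: w) (i + 1) = entry w i := by
  obtain ⟨i, rfl⟩ := Nat.exists_eq_add_of_le' hi
  simp [entry]

/-- The number of interior positions of `w` whose letter and two neighbours satisfy `Q`. -/
def localCount (Q : ℕ → ℕ → ℕ → Prop) [∀ a b c, Decidable (Q a b c)] (w : List ℕ) : ℕ :=
  #{i ∈ Icc 2 (w.length - 1) | Q (entry w (i - 1)) (entry w i) (entry w (i + 1))}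

theorem localCount_cons (Q : ℕ → ℕ → ℕ → Prop) [∀ a b c, Decidable (Q a b c)] (x y z : ℕ)
    (l : List ℕ) : localCount Q (x :: y :: z :: l) =
      (if Q x y z then 1 else 0) + localCount Q (y :: z :: l) := by
  have h : Icc 2 ((x :: y :: z :: l).length - 1) =
      insert 2 ((Icc 2 ((y :: z :: l).length - 1)).map (addRightEmbedding 1)) := by
    rw [map_add_right_Icc]
    ext i
    simp
    omega
  simp only [localCount]
  rw [h, filter_insert, filter_map]
  have h2 : (entry (x :: y :: z :: l) (2 - 1)) = x ∧ (entry (x :: y :: z :: l) 2) = y ∧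
      entry (x :: y :: z :: l) (2 + 1) = z := by simp [entry]
  have h3 : filter ((fun i => Q (entry (x :: y :: z :: l) (i - 1)) (entry (x :: y :: z :: l) i)
        (entry (x :: y :: z :: l) (i + 1))) ∘ (addRightEmbedding 1))
        (Icc 2 ((y :: z :: l).length - 1)) =
      {i ∈ Icc 2 ((y :: z :: l).length - 1) | Q (entry (y :: z :: l) (i - 1))
        (entry (y :: z :: l) i) (entry (y :: z :: l) (i + 1))} := by
    refine filter_congr fun i hi => ?_
    rw [mem_Icc] at hi
    obtain ⟨i, rfl⟩ := Nat.exists_eq_add_of_le' hi.1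
    simp only [Function.comp, addRightEmbedding_apply, Nat.add_sub_cancel]
    rw [entry_cons_succ x _ (i := i + 2) (by omega), entry_cons_succ x _ (i := i + 2 + 1) (by omega),
      ← entry_cons_succ x _ (i := i + 2 - 1) (by omega)]
    simp only [Nat.reduceSubDiff]
  rw [h3, h2.1, h2.2.1, h2.2.2]
  split_ifs
  · rw [card_insert_of_notMem, card_map, add_comm]
    simp
  · rw [card_map, zero_add]

theorem localCount_of_length_le (Q : ℕ → ℕ → ℕ → Prop) [∀ a b c, Decidable (Q a b c)]
    {w : List ℕ} (h : w.length ≤ 2) : localCount Q w = 0 := by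
  rw [localCount, card_eq_zero, filter_eq_empty_iff]
  intro i hi
  rw [mem_Icc] at hi
  omega

/-- The turning points of a word: an inner letter is a peak or a valley. -/
def IsTurn (x y z : ℕ) : Prop := (x < y ∧ y > z) ∨ (x > y ∧ y < z)

instance (x y z : ℕ) : Decidable (IsTurn x y z) := by
  unfold IsTurn; infer_instance

theorem entry_ne_of_isChain {w : List ℕ} (hw : w.IsChain (· ≠ ·)) {i : ℕ} (h1 : 1 ≤ i)
    (h2 : i + 1 ≤ w.length) : entry w i ≠ entry w (i + 1) := by
  obtain ⟨i, rfl⟩ := Nat.exists_eq_add_of_le' h1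
  have := List.isChain_iff_getElem.1 hw i (by omega)
  simpa [entry, List.getD_eq_getElem?_getD, List.getElem?_eq_getElem (show i < w.length by omega),
    List.getElem?_eq_getElem (show i + 1 < w.length by omega)] using this

theorem MonotoneFactor.mono {w : List ℕ} {i j i' j' : ℕ} (h : MonotoneFactor w i j)
    (hi : i ≤ i') (hj : j' ≤ j) : MonotoneFactor w i' j' := by
  have : Ico i' j' ⊆ Ico i j := Ico_subset_Ico hi hj
  exact h.imp (fun h k hk => h k (this hk)) (fun h k hk => h k (this hk))

theorem monotoneFactor_succ {w : List ℕ} (hw : w.IsChain (· ≠ ·)) {i : ℕ} (h1 : 1 ≤ i)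
    (h2 : i + 1 ≤ w.length) : MonotoneFactor w i (i + 1) := by
  rcases lt_or_gt_of_ne (entry_ne_of_isChain hw h1 h2) with h | h
  · left
    simpa using h
  · right
    simpa using h

theorem not_monotoneFactor_of_isTurn {w : List ℕ} {i j p : ℕ}
    (h : IsTurn (entry w (p - 1)) (entry w p) (entry w (p + 1))) (hi : i + 1 ≤ p)
    (hj : p + 1 ≤ j) : ¬ MonotoneFactor w i j := by
  have hp : p - 1 + 1 = p := by omega
  rintro (h' | h')
  · have a := h' (p - 1) (by simp; omega)
    have b := h' p (by simp; omega)
    rw [hp] at a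
    rcases h with h | h <;> omega
  · have a := h' (p - 1) (by simp; omega)
    have b := h' p (by simp; omega)
    rw [hp] at a
    rcases h with h | h <;> omega

theorem monotoneFactor_extend {w : List ℕ} (hw : w.IsChain (· ≠ ·)) {i j : ℕ} (hi : 2 ≤ i)
    (hij : i + 1 ≤ j) (hj : j ≤ w.length)
    (h : ¬ IsTurn (entry w (i - 1)) (entry w i) (entry w (i + 1))) (hm : MonotoneFactor w i j) :
    MonotoneFactor w (i - 1) j := by
  have n1 := entry_ne_of_isChain hw (show 1 ≤ i - 1 by omega) (by omega)
  rw [show i - 1 + 1 = i by omega] at n1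
  simp only [IsTurn, not_or, not_and] at h
  rcases hm with hm | hm
  · left
    have b := hm i (by simp; omega)
    intro k hk
    rw [mem_Ico] at hk
    rcases Nat.lt_or_ge k i with hlt | hge
    · obtain rfl : k = i - 1 := by omega
      rw [show i - 1 + 1 = i by omega]
      omega
    · exact hm k (mem_Ico.2 ⟨hge, hk.2⟩)
  · right
    have b := hm i (by simp; omega)
    intro k hk
    rw [mem_Ico] at hk
    rcases Nat.lt_or_ge k i with hlt | hge
    · obtain rfl : k = i - 1 := by omega
      rw [show i - 1 + 1 = i by omega]
      omega
    · exact hm k (mem_Ico.2 ⟨hge, hk.2⟩)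

/-- The biruns of a word start at its first letter and at its turning points. -/
theorem image_fst_biruns {w : List ℕ} (hw : w.IsChain (· ≠ ·)) (hl : 2 ≤ w.length) :
    (biruns w).image Prod.fst = insert 1 {i ∈ Icc 2 (w.length - 1) |
      IsTurn (entry w (i - 1)) (entry w i) (entry w (i + 1))} := by
  ext i
  simp only [mem_image, biruns, mem_filter, mem_product, mem_Icc, mem_insert, Prod.exists,
    exists_and_right, exists_eq_right]
  constructor
  · rintro ⟨j, ⟨⟨hi1, hi2⟩, hj1, hj2⟩, hij, hm, hmax⟩
    simp only [mem_Icc] at hmax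
    by_cases h1 : i = 1
    · exact Or.inl h1
    right
    -- The last letter alone is not a birun: together with its predecessor it forms a monotone
    -- factor.
    have hi : i + 1 ≤ w.length := by
      by_contra hcon
      obtain rfl : i = w.length := by omega
      obtain rfl : j = w.length := by omega
      have := hmax (w.length - 1) ⟨by omega, by omega⟩ w.length ⟨le_rfl, le_rfl⟩ (by
        have := monotoneFactor_succ hw (i := w.length - 1) (by omega) (by omega)
        rwa [show w.length - 1 + 1 = w.length by omega] at this)
      omega
    have hij' : i + 1 ≤ j := by
      by_contra hcon
      obtain rfl : j = i := by omega
      have := hmax j ⟨by omega, le_rfl⟩ (j + 1) ⟨by omega, hi⟩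
        (monotoneFactor_succ hw (by omega) hi)
      omega
    refine ⟨by omega, ?_⟩
    by_contra ht
    have := hmax (i - 1) ⟨by omega, by omega⟩ j ⟨le_rfl, hj2⟩
      (monotoneFactor_extend hw (by omega) hij' hj2 ht hm)
    omega
  · intro h
    have hi : 1 ≤ i ∧ i + 1 ≤ w.length := by omega
    -- The birun starting at `i` is the longest monotone factor starting there; it cannot be
    -- extended to the left past a turning point.
    have hne : ({j ∈ Icc (i + 1) w.length | MonotoneFactor w i j}).Nonempty :=
      ⟨i + 1, by simpa [hi.2] using monotoneFactor_succ hw hi.1 hi.2⟩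
    have hmem := max'_mem _ hne
    have hle := fun j => le_max' {j ∈ Icc (i + 1) w.length | MonotoneFactor w i j} j
    set j := max' _ hne
    simp only [mem_filter, mem_Icc] at hmem hle
    refine ⟨j, ⟨⟨hi.1, by omega⟩, by omega, by omega⟩, by omega, hmem.2, ?_⟩
    intro i' hi' j' hj' hm
    rw [mem_Icc] at hi' hj'
    have hjj := hle j' ⟨⟨by omega, hj'.2⟩, hm.mono hi'.2 le_rfl⟩
    refine ⟨?_, by omega⟩
    by_contra hcon
    rcases h with h | h
    · omega
    · exact not_monotoneFactor_of_isTurn h.2 (by omega) (by omega) hm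

theorem card_biruns {w : List ℕ} (hw : w.IsChain (· ≠ ·)) (hl : 2 ≤ w.length) :
    #(biruns w) = localCount IsTurn w + 1 := by
  have hinj : Set.InjOn Prod.fst (biruns w : Set (ℕ × ℕ)) := by
    rintro ⟨i, j⟩ h ⟨i', j'⟩ h' (rfl : i = i')
    simp only [biruns, coe_filter, mem_product, mem_Icc, Set.mem_ofPred_eq] at h h'
    obtain ⟨⟨_, _, hj⟩, _, hm, hmax⟩ := h
    obtain ⟨⟨_, _, hj'⟩, _, hm', hmax'⟩ := h'
    rcases le_total j j' with hle | hle
    · have := hmax i (by simp; omega) j' (by simp; omega) hm'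
      simp [this.2]
    · have := hmax' i (by simp; omega) j (by simp; omega) hm
      simp [this.2]
  rw [← card_image_of_injOn hinj, image_fst_biruns hw hl, card_insert_of_notMem, localCount]
  simp

/-! ### The statistics in terms of runs -/

theorem localCount_isTurn (x y : ℕ) (l : List ℕ) (h : (x :: y :: l).IsChain (· ≠ ·)) :
    localCount IsTurn (x :: y :: l) + 1 = runs (decide (x < y)) (y :: l) := by
  induction l generalizing x y with
  | nil => simp [localCount_of_length_le, runs]
  | cons z l ih =>
    have hxy : x ≠ y := (List.isChain_cons_cons.1 h).1
    have h' := (List.isChain_cons_cons.1 h).2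
    have hyz : y ≠ z := (List.isChain_cons_cons.1 h').1
    have e := ih y z h'
    rw [localCount_cons, runs]
    by_cases hd : decide (y < z) = decide (x < y)
    · have ht : ¬ IsTurn x y z := by
        rw [decide_eq_decide] at hd
        simp only [IsTurn]
        omega
      rw [if_neg ht, if_pos hd, zero_add, e, hd]
    · have ht : IsTurn x y z := by
        rw [decide_eq_decide] at hd
        simp only [IsTurn]
        omega
      rw [if_pos ht, if_neg hd, ← Bool.eq_not.2 hd, ← e]
      omega

theorem pk_eq_localCount (w : List ℕ) :
    pk w = localCount (fun x y z => x < y ∧ y > z) w := rfl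

/-- With initial direction `false`, the ascending runs are those in even position, and a peak is the
end of an ascending run that is followed by another run. -/
theorem pk_eq_runs (l : List ℕ) (h : l.IsChain (· ≠ ·)) : pk l = (runs false l - 1) / 2 := by
  rw [pk_eq_localCount]
  induction l with
  | nil => simp [localCount_of_length_le, runs]
  | cons x l ih =>
    match l with
    | [] => simp [localCount_of_length_le, runs]
    | [y] =>
      rw [localCount_of_length_le _ (by simp)]
      simp only [runs]
      split_ifs <;> simp
    | y :: z :: l =>
      have hxy : x ≠ y := (List.isChain_cons_cons.1 h).1
      have h' := (List.isChain_cons_cons.1 h).2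
      have hyz : y ≠ z := (List.isChain_cons_cons.1 h').1
      have e := ih h'
      have p1 := one_le_runs true (z :: l)
      have p2 := one_le_runs false (z :: l)
      rw [localCount_cons, e]
      simp only [runs, decide_eq_false_iff_not, decide_eq_true_eq, Bool.not_false, Bool.not_true]
      split_ifs <;> omega

theorem runs_cons_zero (b : Bool) (π : List ℕ) (hπ : π ≠ []) (h : ∀ x ∈ π, 0 < x) :
    runs b (0 :: π) = if b then runs true π else runs true π + 1 := by
  match π with
  | x :: l =>
    have hx := h x (by simp)
    cases b <;> simp [runs, hx]

/-- The step to a final 0 is never an ascent, so the last run is descending. This rounds the number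
of runs up to even or odd, according to the initial direction. -/
theorem runs_append_zero (π : List ℕ) (hπ : π ≠ []) :
    runs true (π ++ [0]) = 2 * ((runs true π + 1) / 2) ∧
      runs false (π ++ [0]) = 2 * (runs false π / 2) + 1 := by
  induction π with
  | nil => exact absurd rfl hπ
  | cons x l ih =>
    match l with
    | [] => simp [runs]
    | y :: l =>
      have e := ih (by simp)
      simp only [List.cons_append, runs, decide_eq_false_iff_not, decide_eq_true_eq,
        Bool.not_false, Bool.not_true] at e ⊢
      split_ifs <;> omega

theorem IsPermutation.isChain {π : List ℕ} (h : IsPermutation π) : π.IsChain (· ≠ ·) :=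
  List.Pairwise.isChain h.1

theorem IsPermutation.isChain_cons_zero {π : List ℕ} (h : IsPermutation π) :
    (0 :: π).IsChain (· ≠ ·) := by
  refine List.Pairwise.isChain (List.pairwise_cons.2 ⟨fun x hx => ?_, h.1⟩)
  exact (h.2 x hx).ne

theorem IsPermutation.isChain_append_zero {π : List ℕ} (h : IsPermutation π) :
    (π ++ [0]).IsChain (· ≠ ·) := by
  refine List.Pairwise.isChain (List.pairwise_append.2 ⟨h.1, by simp, fun x hx y hy => ?_⟩)
  rw [List.mem_singleton.1 hy]
  exact (h.2 x hx).ne'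

theorem udr_eq_runs {π : List ℕ} (h : IsPermutation π) (hπ : π ≠ []) : udr π = runs true π := by
  match π with
  | x :: l =>
    rw [udr, card_biruns h.isChain_cons_zero (by simp), localCount_isTurn _ _ _ h.isChain_cons_zero]
    simp [h.2 x]

theorem lpk_eq_runs {π : List ℕ} (h : IsPermutation π) (hπ : π ≠ []) :
    lpk π = runs true π / 2 := by
  rw [lpk, pk_eq_runs _ h.isChain_cons_zero, runs_cons_zero _ _ hπ h.2]
  simp

theorem rpk_eq_runs {π : List ℕ} (h : IsPermutation π) (hπ : π ≠ []) :
    rpk π = runs false π / 2 := by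
  rw [rpk, pk_eq_runs _ h.isChain_append_zero, (runs_append_zero π hπ).2]
  omega

theorem epk_eq_runs {π : List ℕ} (h : IsPermutation π) (hπ : π ≠ []) :
    epk π = (runs true π + 1) / 2 := by
  match π with
  | x :: l =>
    have hx : 0 < x := h.2 x (by simp)
    have hc : (0 :: (x :: l ++ [0])).IsChain (· ≠ ·) := by
      rw [List.cons_append, List.isChain_cons_cons]
      exact ⟨hx.ne, h.isChain_append_zero⟩
    have e : runs false (0 :: (x :: l ++ [0])) = runs true (x :: l ++ [0]) + 1 := by
      simp [runs, hx]
    rw [epk, pk_eq_runs _ hc, e, (runs_append_zero _ hπ).1]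
    omega

theorem runs_map {f : ℕ → ℕ} (b : Bool) (π : List ℕ) (hf : StrictMonoOn f {x | x ∈ π}) :
    runs b (π.map f) = runs b π := by
  induction π generalizing b with
  | nil => simp [runs]
  | cons x l ih =>
    match l with
    | [] => simp [runs]
    | y :: l =>
      have hf' : StrictMonoOn f {x | x ∈ y :: l} :=
        hf.mono fun z (hz : z ∈ y :: l) => List.mem_cons_of_mem x hz
      have e : decide (f x < f y) = decide (x < y) := by
        rw [decide_eq_decide]
        exact hf.lt_iff_lt (List.mem_cons_self ..) (List.mem_cons_of_mem _ (List.mem_cons_self ..))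
      have i1 := ih b hf'
      have i2 := ih (!b) hf'
      simp only [List.map_cons] at i1 i2 ⊢
      rw [runs, runs, e, i1, i2]

theorem isPermutationStatistic_of_runs {α : Type*} {St : List ℕ → α} (g : ℕ → ℕ → α)
    (h : ∀ π, IsPermutation π → π ≠ [] → St π = g (runs true π) (runs false π)) :
    IsPermutationStatistic St := by
  rintro π _ hπ hπ' ⟨f, hf, rfl⟩
  by_cases h0 : π = []
  · simp [h0]
  · rw [h π hπ h0, h _ hπ' (by simpa using h0), runs_map _ _ hf, runs_map _ _ hf]

/-! ### Shuffle compatibility -/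

theorem shuffleCompatible_runs (b : Bool) : ShuffleCompatible (runs b) := by
  refine shuffleCompatible_of_characters (isPermutationStatistic_of_runs
    (fun r s => if b then r else s) fun π _ _ => by cases b <;> simp) (fun k => zigzag b k)
    (fun k => isShuffleCharacter_zigzag b k) ?_ ?_ ?_
  · exact fun k π π' _ _ h0 h0' hl hr => zigzag_congr h0 h0' hl hr k
  · exact fun k π _ h0 hk => zigzag_eq_zero h0 hk
  · exact fun π _ h0 => zigzag_ne_zero h0 le_rfl

theorem shuffleCompatible_of_eq_runs_div_two {St : List ℕ → ℕ} (b : Bool)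
    (h : ∀ π, IsPermutation π → π ≠ [] → St π = runs b π / 2) : ShuffleCompatible St := by
  refine shuffleCompatible_of_characters (isPermutationStatistic_of_runs
    (fun r s => (if b then r else s) / 2) fun π hπ h0 => by rw [h π hπ h0]; cases b <;> simp)
    -- Odd indices merge 2m with 2m + 1 runs, and r ≤ 2k + 1 is equivalent to ⌊r/2⌋ ≤ k.
    (fun k => zigzag b (2 * k + 1)) (fun k => isShuffleCharacter_zigzag b _) ?_ ?_ ?_
  · intro k π π' hπ hπ' h0 h0' hl hr
    rw [h π hπ h0, h π' hπ' h0'] at hr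
    exact zigzag_congr_of_succ_or_eq h0 h0' hl (by omega)
  · intro k π hπ h0 hk
    rw [h π hπ h0] at hk
    exact zigzag_eq_zero h0 (by omega)
  · intro π hπ h0
    rw [h π hπ h0]
    exact zigzag_ne_zero h0 (by omega)

theorem shuffleCompatible_epk : ShuffleCompatible epk := by
  refine shuffleCompatible_of_characters (isPermutationStatistic_of_runs
    (fun r _ => (r + 1) / 2) fun π hπ h0 => epk_eq_runs hπ h0)
    -- Even indices merge 2m - 1 with 2m runs, and r ≤ 2k is equivalent to ⌈r/2⌉ ≤ k.
    (fun k => zigzag true (2 * k)) (fun k => isShuffleCharacter_zigzag true _) ?_ ?_ ?_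
  · intro k π π' hπ hπ' h0 h0' hl hr
    rw [epk_eq_runs hπ h0, epk_eq_runs hπ' h0'] at hr
    exact zigzag_congr_of_succ_or_eq h0 h0' hl (by omega)
  · intro k π hπ h0 hk
    rw [epk_eq_runs hπ h0] at hk
    exact zigzag_eq_zero h0 (by omega)
  · intro π hπ h0
    rw [epk_eq_runs hπ h0]
    exact zigzag_ne_zero h0 (by omega)

theorem shuffleCompatible_udr : ShuffleCompatible udr := by
  refine shuffleCompatible_of_characters (isPermutationStatistic_of_runs
    (fun r _ => r) fun π hπ h0 => udr_eq_runs hπ h0)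
    (fun k => zigzag true k) (fun k => isShuffleCharacter_zigzag true _) ?_ ?_ ?_
  · intro k π π' hπ hπ' h0 h0' hl hr
    rw [udr_eq_runs hπ h0, udr_eq_runs hπ' h0'] at hr
    exact zigzag_congr h0 h0' hl hr k
  · intro k π hπ h0 hk
    rw [udr_eq_runs hπ h0] at hk
    exact zigzag_eq_zero h0 hk
  · intro π hπ h0
    rw [udr_eq_runs hπ h0]
    exact zigzag_ne_zero h0 le_rfl

/-- The first step has exactly one of the two directions; prescribing the other one makes the first
letter an additional run. -/
theorem runs_false_eq_or (π : List ℕ) (h : 2 ≤ π.length) :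
    runs false π = runs true π + 1 ∨ runs true π = runs false π + 1 := by
  match π with
  | x :: y :: l =>
    simp only [runs, decide_eq_false_iff_not, decide_eq_true_eq, Bool.not_false, Bool.not_true]
    split_ifs <;> omega

/-- Given r, the candidates for s are r - 1 and r + 1, and these give different values of ⌊(s-1)/2⌋.
Words with one letter have s = 1. -/
theorem runs_false_eq_of_udr_pk {π π' : List ℕ} (hπ : IsPermutation π) (hπ' : IsPermutation π')
    (h0 : π ≠ []) (h0' : π' ≠ []) (hl : π.length = π'.length) (hu : udr π = udr π')
    (hp : pk π = pk π') : runs false π = runs false π' := by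
  rw [udr_eq_runs hπ h0, udr_eq_runs hπ' h0'] at hu
  rw [pk_eq_runs _ hπ.isChain, pk_eq_runs _ hπ'.isChain] at hp
  by_cases h2 : 2 ≤ π.length
  · have e := runs_false_eq_or π h2
    have e' := runs_false_eq_or π' (hl ▸ h2)
    have := one_le_runs false π
    have := one_le_runs false π'
    omega
  · match π, π' with
    | [x], [y] => simp [runs]
    | x :: y :: l, _ => simp at h2

theorem shuffleCompatible_udr_pk : ShuffleCompatible fun π : List ℕ => (udr π, pk π) := by
  have hst : ∀ π, IsPermutation π → π ≠ [] →
      (udr π, pk π) = (runs true π, (runs false π - 1) / 2) := fun π hπ h0 => by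
    rw [udr_eq_runs hπ h0, pk_eq_runs π hπ.isChain]
  refine shuffleCompatible_of_nonempty
    (isPermutationStatistic_of_runs (fun r s => (r, (s - 1) / 2)) hst) ?_
  intro π π' σ σ' hπ hπ' hσ hσ' hπ0 hπ0' hσ0 hσ0' hl1 hl2 hd hd' h1 h2
  obtain ⟨hu1, hp1⟩ := Prod.mk.inj h1
  obtain ⟨hu2, hp2⟩ := Prod.mk.inj h2
  have hf1 := runs_false_eq_of_udr_pk hπ hπ' hπ0 hπ0' hl1 hu1 hp1
  have hf2 := runs_false_eq_of_udr_pk hσ hσ' hσ0 hσ0' hl2 hu2 hp2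
  rw [udr_eq_runs hπ hπ0, udr_eq_runs hπ' hπ0'] at hu1
  rw [udr_eq_runs hσ hσ0, udr_eq_runs hσ' hσ0'] at hu2
  have m1 := (shuffleCompatible_runs true).2 π π' σ σ' hπ hπ' hσ hσ' hl1 hl2 hd hd' hu1 hu2
  have m2 := (shuffleCompatible_runs false).2 π π' σ σ' hπ hπ' hσ hσ' hl1 hl2 hd hd' hf1 hf2
  -- Shuffles of nonempty words have at least two letters, so r and s differ by 1 on each of them.
  have hadj : ∀ π σ : List ℕ, π ≠ [] → σ ≠ [] →
      ∀ p ∈ distribution (fun τ => (runs true τ, runs false τ)) (shuffles π σ),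
        p.2 = p.1 + 1 ∨ p.1 = p.2 + 1 := by
    intro π σ h h' p hp
    obtain ⟨τ, hτ, rfl⟩ := Multiset.mem_map.1 hp
    have := length_of_mem_shuffles hτ
    have := List.length_pos_iff.2 h
    have := List.length_pos_iff.2 h'
    exact runs_false_eq_or τ (by omega)
  have hjoint := multiset_eq_of_marginals (hadj π σ hπ0 hσ0) (hadj π' σ' hπ0' hσ0')
    (by simpa [distribution, Function.comp_def] using m1)
    (by simpa [distribution, Function.comp_def] using m2)
  have hmap : ∀ π σ : List ℕ, IsPermutation π → IsPermutation σ → π.Disjoint σ → π ≠ [] →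
      distribution (fun τ : List ℕ => (udr τ, pk τ)) (shuffles π σ) =
        (distribution (fun τ => (runs true τ, runs false τ)) (shuffles π σ)).map
          (fun p => (p.1, (p.2 - 1) / 2)) := by
    intro π σ hπ hσ hd h0
    rw [distribution, distribution, Multiset.map_map]
    refine Multiset.map_congr rfl fun τ hτ => ?_
    refine hst τ (isPermutation_of_mem_shuffles hπ hσ hd hτ) ?_
    rintro rfl
    have := length_of_mem_shuffles hτ
    have := List.length_pos_iff.2 h0
    simp at *
    omega
  rw [hmap π σ hπ hσ hd hπ0, hmap π' σ' hπ' hσ' hd' hπ0', hjoint]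

end ShuffleCompat

theorem mainTheorem4 :
    ShuffleCompat.ShuffleCompatible ShuffleCompat.lpk ∧
    ShuffleCompat.ShuffleCompatible ShuffleCompat.rpk ∧
    ShuffleCompat.ShuffleCompatible ShuffleCompat.epk ∧
    ShuffleCompat.ShuffleCompatible ShuffleCompat.udr ∧
    ShuffleCompat.ShuffleCompatible
      (fun π : List ℕ => (ShuffleCompat.udr π, ShuffleCompat.pk π)) :=
  ⟨ShuffleCompat.shuffleCompatible_of_eq_runs_div_two true
      fun _ hπ h0 => ShuffleCompat.lpk_eq_runs hπ h0,
    ShuffleCompat.shuffleCompatible_of_eq_runs_div_two false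
      fun _ hπ h0 => ShuffleCompat.rpk_eq_runs hπ h0,
    ShuffleCompat.shuffleCompatible_epk, ShuffleCompat.shuffleCompatible_udr,
    ShuffleCompat.shuffleCompatible_udr_pk⟩
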